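/- For $D>2$ let $\theta(D)\in(0,1)$ denote the unique solution $\theta\in(0,1)$ of the equation $$\frac{2}{D}=(1-\theta)\,\theta^{\frac{\theta}{1-\theta}}.$$ A metric space $(U,\rho)$ is called an ultrametric space if $\rho(x,y)\le\max\{\rho(x,z),\rho(z,y)\}$ for all $x,y,z\in U$. A metric space $(S,d)$ is said to embed with distortion $D$ into a metric space $(U,\rho)$ if there exist $f:S\to U$ and $\lambda>0$ such that $\lambda d(x,y)\le\rho(f(x),f(y))\le D\lambda d(x,y)$ for all $x,y\in S$. **Theorem.** For every $D>2$, every finite metric space $(X,d)$ and every $w:X\to(0,\infty)$, there exists $S\subseteq X$ such that $(S,d)$ embeds with distortion $D$ into an ultrametric space and $$\sum_{x\in S}w(x)^{\theta(D)}\ \ge\ \Big(\sum_{x\in X}w(x)\Big)^{\theta(D)}.$$ -/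

import Mathlib

open Finset

universe u v

/-- The metric space `X` embeds with distortion `D` into the metric space `Y`: there are a map
`f : X → Y` and a scaling factor `lam > 0` such that
`lam * d(x, y) ≤ d(f x, f y) ≤ D * lam * d(x, y)` for all `x, y`. -/
def EmbedsWithDistortion (D : ℝ) (X : Type u) (Y : Type v) [MetricSpace X] [MetricSpace Y] :
    Prop :=
  ∃ (f : X → Y) (lam : ℝ), 0 < lam ∧
    ∀ x y : X, lam * dist x y ≤ dist (f x) (f y) ∧ dist (f x) (f y) ≤ D * lam * dist x y

/-- The metric space `X` embeds with distortion `D` into some ultrametric space. (Restricting an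
ultrametric space to the image of `X` shows that the universe of `X` is large enough.) -/
def EmbedsIntoUltrametric (D : ℝ) (X : Type u) [MetricSpace X] : Prop :=
  ∃ (U : Type u) (_ : MetricSpace U), IsUltrametricDist U ∧ EmbedsWithDistortion D X U

/-- On `[0, 1)`, the logarithm of `(1 - t) * t ^ (t / (1 - t))` is strictly decreasing. -/
theorem strictAntiOn_log_exponent :
    StrictAntiOn (fun t : ℝ => Real.log (1 - t) + t * Real.log t / (1 - t)) (Set.Ico 0 1) := by
  have hcont : ContinuousOn (fun t : ℝ => Real.log (1 - t) + t * Real.log t / (1 - t))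
      (Set.Ico 0 1) := by
    have h1 : ∀ t ∈ Set.Ico (0 : ℝ) 1, 1 - t ≠ 0 := fun t ht => by
      have := ht.2
      intro h
      linarith
    refine ContinuousOn.add (ContinuousOn.log (by fun_prop) h1) ?_
    exact ContinuousOn.div Real.continuous_mul_log.continuousOn (by fun_prop) h1
  refine strictAntiOn_of_deriv_neg (convex_Ico 0 1) hcont ?_
  intro t ht
  rw [interior_Ico] at ht
  have h0 : 0 < t := ht.1
  have h1 : 0 < 1 - t := by linarith [ht.2]
  have hsub : HasDerivAt (fun s : ℝ => 1 - s) (-1) t := by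
    simpa using (hasDerivAt_id t).const_sub 1
  have hd := (hsub.log h1.ne').add ((Real.hasDerivAt_mul_log h0.ne').div hsub h1.ne')
  have hd' : deriv (fun t : ℝ => Real.log (1 - t) + t * Real.log t / (1 - t)) t
      = Real.log t / (1 - t) ^ 2 := by
    refine HasDerivAt.deriv (hd.congr_deriv ?_)
    field_simp
    ring
  rw [hd']
  exact div_neg_of_neg_of_pos (Real.log_neg h0 ht.2) (by positivity)

/-- On `(0, 1)`, the defining equation is equivalent to its logarithmic form. -/
theorem exponent_eq_iff {D t : ℝ} (hD : 2 < D) (h0 : 0 < t) (h1 : t < 1) :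
    2 / D = (1 - t) * t ^ (t / (1 - t)) ↔
      Real.log (1 - t) + t * Real.log t / (1 - t) = Real.log (2 / D) := by
  have h2 : 0 < 1 - t := by linarith
  have hp : 0 < t ^ (t / (1 - t)) := Real.rpow_pos_of_pos h0 _
  have hlog : Real.log ((1 - t) * t ^ (t / (1 - t)))
      = Real.log (1 - t) + t * Real.log t / (1 - t) := by
    rw [Real.log_mul h2.ne' hp.ne', Real.log_rpow h0]
    ring
  rw [← hlog]
  constructor
  · intro h
    rw [h]
  · intro h
    exact (Real.log_injOn_pos (Set.mem_Ioi.2 (mul_pos h2 hp))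
      (Set.mem_Ioi.2 (by positivity)) h).symm

/-- For `D > 2` the equation `2 / D = (1 - t) * t ^ (t / (1 - t))` has exactly one solution in
`(0, 1)`. -/
theorem existsUnique_exponent (D : ℝ) (hD : 2 < D) :
    ∃! t : ℝ, t ∈ Set.Ioo (0 : ℝ) 1 ∧ 2 / D = (1 - t) * t ^ (t / (1 - t)) := by
  have hD0 : 0 < 2 / D := by positivity
  have hD1 : 2 / D < 1 := by rw [div_lt_one (by linarith)]; exact hD
  have hlog : Real.log (2 / D) < 0 := Real.log_neg hD0 hD1
  have hanti := strictAntiOn_log_exponent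
  have hcont : ContinuousOn (fun t : ℝ => Real.log (1 - t) + t * Real.log t / (1 - t))
      (Set.Icc 0 (1 - 2 / D)) := by
    have h1 : ∀ t ∈ Set.Icc (0 : ℝ) (1 - 2 / D), 1 - t ≠ 0 := fun t ht => by
      have := ht.2
      intro h
      linarith
    refine ContinuousOn.add (ContinuousOn.log (by fun_prop) h1) ?_
    exact ContinuousOn.div Real.continuous_mul_log.continuousOn (by fun_prop) h1
  have hmem : Real.log (2 / D) ∈ Set.Icc
      ((fun t : ℝ => Real.log (1 - t) + t * Real.log t / (1 - t)) (1 - 2 / D))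
      ((fun t : ℝ => Real.log (1 - t) + t * Real.log t / (1 - t)) 0) := by
    constructor
    · have h2 : (1 - 2 / D) * Real.log (1 - 2 / D) / (2 / D) ≤ 0 :=
        div_nonpos_of_nonpos_of_nonneg
          (mul_nonpos_of_nonneg_of_nonpos (by linarith)
            (Real.log_nonpos (by linarith) (by linarith))) hD0.le
      simp only [sub_sub_cancel]
      linarith
    · simpa using hlog.le
  obtain ⟨t, ht, hteq⟩ := intermediate_value_Icc' (by linarith) hcont hmem
  simp only at hteq
  have ht1 : t < 1 := by linarith [ht.2]
  have ht0 : 0 < t := by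
    rcases ht.1.lt_or_eq with h | h
    · exact h
    · rw [← hteq, ← h] at hlog
      simp at hlog
  refine ⟨t, ⟨⟨ht0, ht1⟩, (exponent_eq_iff hD ht0 ht1).2 hteq⟩, ?_⟩
  rintro s ⟨⟨hs0, hs1⟩, hs⟩
  refine hanti.injOn ⟨hs0.le, hs1⟩ ⟨ht0.le, ht1⟩ ?_
  rw [(exponent_eq_iff hD hs0 hs1).1 hs, hteq]

/-- For `D > 2`, the number `θ(D)`: the unique solution in `(0, 1)` of
`2 / D = (1 - θ) * θ ^ (θ / (1 - θ))`. -/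
noncomputable def dvoretzkyExponent (D : ℝ) (hD : 2 < D) : ℝ :=
  (existsUnique_exponent D hD).choose

theorem dvoretzkyExponent_spec (D : ℝ) (hD : 2 < D) :
    dvoretzkyExponent D hD ∈ Set.Ioo (0 : ℝ) 1 ∧
      2 / D = (1 - dvoretzkyExponent D hD) *
        dvoretzkyExponent D hD ^ (dvoretzkyExponent D hD / (1 - dvoretzkyExponent D hD)) :=
  (existsUnique_exponent D hD).choose_spec.1

/-! Draw centres in `w`-random order; each keeps the remaining points within `R` and discards those
out to `R + t`. The first centre in the `(R + t)`-ball of `x` decides its fate, so `x` survives with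
probability equal to a ratio of ball weights. `exists_fragmentation` derandomizes this, and
`exists_subset_ultrametric` iterates it with `t = 2 / D * R n`, multiplying the ratios.

For radii `M * s ^ (r + n)`, the identity `s + 2 / D = s ^ θ` makes enlarging a ball a shift by `1 -
θ` in the exponent. Averaged over `r`, the logarithmic losses telescope to at most `(1 - θ) * log (W
/ w x)`, where `W` is the total weight (`exists_shift_sum_le`). Convexity of `exp` under the
probability weights `w x / W` turns this into the bound `W ^ θ`. -/

/-- The total weight of the points of `C` in the closed ball of radius `r` around `x`. -/
noncomputable def ballWeight {X : Type u} [MetricSpace X] (w : X → ℝ) (C : Finset X) (x : X)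
    (r : ℝ) : ℝ :=
  ∑ y ∈ C, if dist x y ≤ r then w y else 0

/-! ### Ball weights and fragmentation -/

section BallWeight

variable {X : Type u} [MetricSpace X] {w : X → ℝ}

theorem ballWeight_nonneg (hw : ∀ x, 0 < w x) (C : Finset X) (x : X) (r : ℝ) :
    0 ≤ ballWeight w C x r :=
  Finset.sum_nonneg fun y _ => by split_ifs <;> simp [(hw y).le]

theorem ballWeight_mono (hw : ∀ x, 0 < w x) (C : Finset X) (x : X) :
    Monotone (ballWeight w C x) := by
  intro r s hrs
  refine Finset.sum_le_sum fun y _ => ?_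
  split_ifs with h1 h2
  · exact le_rfl
  · exact absurd (h1.trans hrs) h2
  · exact (hw y).le
  · exact le_rfl

theorem ballWeight_le_sum (hw : ∀ x, 0 < w x) (C : Finset X) (x : X) (r : ℝ) :
    ballWeight w C x r ≤ ∑ y ∈ C, w y :=
  Finset.sum_le_sum fun y _ => by split_ifs <;> simp [(hw y).le]

theorem le_ballWeight (hw : ∀ x, 0 < w x) {C : Finset X} {x : X} (hx : x ∈ C) {r : ℝ}
    (hr : 0 ≤ r) : w x ≤ ballWeight w C x r := by
  have h := Finset.single_le_sum (f := fun y => if dist x y ≤ r then w y else 0)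
    (fun y _ => by split_ifs <;> simp [(hw y).le]) hx
  simpa [hr, ballWeight] using h

/-- One step of fragmentation: a part `S` of `A` splits into clusters of radius at most `R` that
are more than `t` apart, and on average a point `x` survives with a probability that is the ratio
of the weights of the balls of radii `R` and `R + t` around it. -/
theorem exists_fragmentation (hw : ∀ x, 0 < w x) {R t : ℝ} (ht : 0 ≤ t) (v : X → ℝ)
    (C A : Finset X) :
    ∃ S ⊆ A, ∃ c : X → X, (∀ x ∈ S, dist x (c x) ≤ R) ∧
      (∀ x ∈ S, ∀ y ∈ S, c x ≠ c y → t < dist x y) ∧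
      ∑ x ∈ A, v x * (ballWeight w C x R / ballWeight w C x (R + t)) ≤ ∑ x ∈ S, v x := by
  classical
  induction hn : C.card generalizing C A with
  | zero =>
    rw [Finset.card_eq_zero] at hn
    subst hn
    -- With no centres left nothing is kept; every ratio is `0 / 0 = 0`.
    exact ⟨∅, by simp, id, by simp, by simp, by simp [ballWeight]⟩
  | succ n ih =>
    have hC : C.Nonempty := Finset.card_pos.1 (by omega)
    set q : X → ℝ := fun x => v x * (ballWeight w C x R / ballWeight w C x (R + t)) with hq
    -- The guaranteed yield if `z` is the first centre: points kept at once, plus the expected yield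
    -- of those beyond the discarded annulus. Its `w`-weighted mean over `C` is exactly `∑ q`, so
    -- some `z` does at least as well.
    set f : X → ℝ := fun z => ∑ x ∈ A,
      ((if dist x z ≤ R then v x else 0) + (if dist x z ≤ R + t then 0 else q x)) with hf
    obtain ⟨z, hz, hfz⟩ : ∃ z ∈ C, ∑ x ∈ A, q x ≤ f z := by
      by_contra! hcon
      have hlt : ∑ z ∈ C, w z * f z < ∑ z ∈ C, w z * ∑ x ∈ A, q x :=
        Finset.sum_lt_sum_of_nonempty hC fun z hz =>
          mul_lt_mul_of_pos_left (hcon z hz) (hw z)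
      refine hlt.not_ge (le_of_eq ?_)
      simp only [hf, Finset.mul_sum]
      rw [Finset.sum_comm, Finset.sum_comm (s := C)]
      refine Finset.sum_congr rfl fun x _ => ?_
      have e1 : ∀ z, w z * ((if dist x z ≤ R then v x else 0)
          + (if dist x z ≤ R + t then 0 else q x))
          = (if dist x z ≤ R then w z else 0) * v x + w z * q x
            - (if dist x z ≤ R + t then w z else 0) * q x := by
        intro z
        split_ifs <;> ring
      simp only [e1, Finset.sum_sub_distrib, Finset.sum_add_distrib, ← Finset.sum_mul]
      change _ = ballWeight w C x R * v x + _ - ballWeight w C x (R + t) * q x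
      have e2 : ballWeight w C x (R + t) * q x = ballWeight w C x R * v x := by
        rcases eq_or_ne (ballWeight w C x (R + t)) 0 with h0 | h0
        · have h1 := ballWeight_mono hw C x (show R ≤ R + t by linarith)
          have h2 := ballWeight_nonneg hw C x R
          have h3 : ballWeight w C x R = 0 := le_antisymm (h1.trans h0.le) h2
          simp [h0, h3]
        · simp only [hq]
          field_simp
      rw [e2]
      ring
    obtain ⟨S, hSA, c, hc1, hc2, hc3⟩ := ih (C.erase z) (A.filter fun x => ¬ dist x z ≤ R + t)
      (by rw [Finset.card_erase_of_mem hz, hn]; rfl)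
    have hfar : ∀ x ∈ S, R + t < dist x z := fun x hx => by
      simpa using (Finset.mem_filter.1 (hSA hx)).2
    have hnear : ∀ x ∈ A.filter (fun x => dist x z ≤ R), dist x z ≤ R := fun x hx =>
      (Finset.mem_filter.1 hx).2
    have hdisj : Disjoint (A.filter fun x => dist x z ≤ R) S := by
      rw [Finset.disjoint_left]
      intro x hx hxS
      linarith [hnear x hx, hfar x hxS]
    refine ⟨A.filter (fun x => dist x z ≤ R) ∪ S,
      Finset.union_subset (Finset.filter_subset _ _) (hSA.trans (Finset.filter_subset _ _)),
      fun x => if dist x z ≤ R then z else c x, ?_, ?_, ?_⟩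
    · intro x hx
      dsimp only
      split_ifs with h
      · exact h
      · rcases Finset.mem_union.1 hx with h1 | h1
        · exact absurd (hnear x h1) h
        · exact hc1 x h1
    · intro x hx y hy hxy
      have key : ∀ x y, dist x z ≤ R → y ∈ S → t < dist x y := fun x y h h' => by
        have h1 := dist_triangle y x z
        rw [dist_comm y x] at h1
        linarith [hfar y h']
      rcases Finset.mem_union.1 hx with h1 | h1 <;> rcases Finset.mem_union.1 hy with h2 | h2
      · simp [hnear x h1, hnear y h2] at hxy
      · exact key x y (hnear x h1) h2
      · rw [dist_comm]
        exact key y x (hnear y h2) h1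
      · have h3 : ¬ dist x z ≤ R := by linarith [hfar x h1]
        have h4 : ¬ dist y z ≤ R := by linarith [hfar y h2]
        simp only [h3, h4, if_false] at hxy
        exact hc2 x h1 y h2 hxy
    · rw [Finset.sum_union hdisj]
      refine hfz.trans ?_
      simp only [hf, Finset.sum_add_distrib]
      rw [← Finset.sum_filter]
      refine add_le_add le_rfl (le_trans (le_of_eq ?_) hc3)
      rw [Finset.sum_filter]
      refine Finset.sum_congr rfl fun x _ => ?_
      by_cases h : dist x z ≤ R + t
      · simp [h]
      -- Erasing `z` does not alter the ball weights of points farther than `R + t` from it, so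
      -- their ratios persist.
      · have e3 : ∀ r ≤ R + t, ballWeight w (C.erase z) x r = ballWeight w C x r := by
          intro r hr
          refine Finset.sum_erase _ ?_
          rw [if_neg (by linarith)]
        rw [if_neg h, if_pos h, e3 _ le_rfl, e3 _ (by linarith)]

/-- Fragmentation along a sequence of scales, together with the ultrametric that it yields. -/
theorem exists_subset_ultrametric [Fintype X] (hw : ∀ x, 0 < w x) {D : ℝ} (hD : 0 < D)
    {R : ℕ → ℝ} (hR : ∀ n, 0 < R n) (hR0 : ∀ x y : X, dist x y ≤ 2 * R 0) (N : ℕ)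
    (v : X → ℝ) :
    ∃ (S : Finset X) (ρ : X → X → ℝ), (∀ x, ρ x x = 0) ∧ (∀ x y, ρ x y = ρ y x) ∧
      (∀ x y z, ρ x z ≤ max (ρ x y) (ρ y z)) ∧
      (∀ x ∈ S, ∀ y ∈ S, ρ x y ≤ D * dist x y ∧ dist x y ≤ max (ρ x y) (2 * R N)) ∧
      ∑ x, v x * ∏ n ∈ Finset.range N, (ballWeight w Finset.univ x (R (n + 1)) /
        ballWeight w Finset.univ x (R (n + 1) + 2 / D * R n)) ≤ ∑ x ∈ S, v x := by
  classical
  induction N generalizing v with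
  | zero =>
    exact ⟨Finset.univ, fun _ _ => 0, by simp, by simp, by simp,
      fun x _ y _ => ⟨by positivity, le_max_of_le_right (hR0 x y)⟩, by simp⟩
  | succ N ih =>
    -- The last ratio is absorbed into the weights beforehand, so that the final fragmentation pays
    -- for it.
    obtain ⟨S, ρ, h0, hs, hu, hd, hsum⟩ := ih fun x => v x *
      (ballWeight w Finset.univ x (R (N + 1)) /
        ballWeight w Finset.univ x (R (N + 1) + 2 / D * R N))
    have ht : 0 ≤ 2 / D * R N := by have := hR N; positivity
    obtain ⟨S', hS', c, hc1, hc2, hc3⟩ := exists_fragmentation hw (R := R (N + 1)) ht v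
      Finset.univ S
    have hRN := hR N
    -- Separated clusters are more than `2 / D * R N` apart, so the value `2 * R N` respects the
    -- upper bound; it also covers the error term in the earlier lower bound.
    refine ⟨S', fun x y => max (ρ x y) (if c x = c y then 0 else 2 * R N), ?_, ?_, ?_, ?_, ?_⟩
    · intro x
      simp [h0]
    · intro x y
      simp only [hs x y, eq_comm (a := c x)]
    · intro x y z
      refine max_le ((hu x y z).trans (max_le_max (le_max_left _ _) (le_max_left _ _))) ?_
      by_cases hxy : c x = c y
      · rw [hxy]
        exact le_max_of_le_right (le_max_right _ _)
      · refine le_max_of_le_left (le_max_of_le_right ?_)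
        rw [if_neg hxy]
        split_ifs <;> linarith
    · intro x hx y hy
      obtain ⟨h1, h2⟩ := hd x (hS' hx) y (hS' hy)
      by_cases hxy : c x = c y
      · simp only [hxy, if_true]
        refine ⟨max_le h1 (by positivity), le_max_of_le_right ?_⟩
        have h3 := hc1 x hx
        have h4 := hc1 y hy
        rw [← hxy] at h4
        linarith [dist_triangle_right x y (c x)]
      · simp only [hxy, if_false]
        refine ⟨max_le h1 ?_, le_max_of_le_left h2⟩
        have h3 := hc2 x hx y hy hxy
        rw [div_mul_eq_mul_div, div_lt_iff₀ hD] at h3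
        linarith
    · refine le_trans (le_of_eq ?_) (hsum.trans hc3)
      refine Finset.sum_congr rfl fun x _ => ?_
      rw [Finset.prod_range_succ]
      ring

end BallWeight

/-! ### Averaging over a common shift of the scales -/

/-- A shift of the scales at which the average telescoping loss is at most its mean. -/
theorem exists_shift_sum_le {ι : Type*} [Fintype ι] {p a : ι → ℝ} {h : ι → ℝ → ℝ} {b κ : ℝ}
    (hp : ∀ x, 0 ≤ p x) (hκ : 0 ≤ κ) (hh : ∀ x, Antitone (h x)) (ha : ∀ x r, a x ≤ h x r)
    (hb : ∀ x r, h x r ≤ b) (N : ℕ) :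
    ∃ r ∈ Set.Icc (0 : ℝ) 1, ∑ x, p x * ∑ n ∈ Finset.range N,
      (h x (r + ((n + 1 : ℕ) : ℝ) - κ) - h x (r + ((n + 1 : ℕ) : ℝ))) ≤
        ∑ x, p x * (κ * (b - a x)) := by
  have hint : ∀ x s t, IntervalIntegrable (h x) MeasureTheory.volume s t := fun x s t =>
    (hh x).intervalIntegrable
  have hint1 : ∀ x (k : ℝ), IntervalIntegrable (fun r => h x (r + k)) MeasureTheory.volume 0 1 :=
    fun x k => Antitone.intervalIntegrable fun r s hrs => hh x (by linarith)
  have hint2 : ∀ x (k : ℝ), IntervalIntegrable (fun r => h x (r + k - κ))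
      MeasureTheory.volume 0 1 :=
    fun x k => Antitone.intervalIntegrable fun r s hrs => hh x (by linarith)
  have hint3 : ∀ x, IntervalIntegrable (fun r => ∑ n ∈ Finset.range N,
      (h x (r + ((n + 1 : ℕ) : ℝ) - κ) - h x (r + ((n + 1 : ℕ) : ℝ)))) MeasureTheory.volume 0 1 :=
    fun x => by
      have := IntervalIntegrable.sum (Finset.range N)
        (f := fun n r => h x (r + ((n + 1 : ℕ) : ℝ) - κ) - h x (r + ((n + 1 : ℕ) : ℝ)))
        (μ := MeasureTheory.volume) (a := 0) (b := 1)
        fun n _ => (hint2 x _).sub (hint1 x _)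
      simpa only [Finset.sum_fn] using this
  have hloss : ∀ x, ∫ r in (0 : ℝ)..1, (∑ n ∈ Finset.range N,
      (h x (r + ((n + 1 : ℕ) : ℝ) - κ) - h x (r + ((n + 1 : ℕ) : ℝ)))) ≤ κ * (b - a x) := by
    intro x
    rw [intervalIntegral.integral_finsetSum fun n _ => (hint2 x _).sub (hint1 x _)]
    -- Exchanging endpoints turns a difference over two unit intervals into one over two intervals
    -- of length `κ`, which telescopes in `n`.
    have e1 : ∀ n : ℕ, ∫ r in (0 : ℝ)..1,
        (h x (r + ((n + 1 : ℕ) : ℝ) - κ) - h x (r + ((n + 1 : ℕ) : ℝ)))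
        = (∫ r in ((n : ℝ) + 1 - κ)..((n : ℝ) + 1), h x r)
          - ∫ r in (((n + 1 : ℕ) : ℝ) + 1 - κ)..(((n + 1 : ℕ) : ℝ) + 1), h x r := by
      intro n
      rw [intervalIntegral.integral_sub (hint2 x _) (hint1 x _)]
      simp only [add_sub_assoc]
      rw [intervalIntegral.integral_comp_add_right, intervalIntegral.integral_comp_add_right]
      rw [intervalIntegral.integral_interval_sub_interval_comm (hint _ _ _) (hint _ _ _)
        (hint _ _ _)]
      push_cast
      congr 2 <;> ring
    rw [Finset.sum_congr rfl fun n _ => e1 n, Finset.sum_range_sub']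
    have e2 : ∀ k : ℝ, (∫ r in (k - κ)..k, h x r) ≤ κ * b := fun k => by
      have := intervalIntegral.integral_mono_on (by linarith) (hint x (k - κ) k)
        intervalIntegrable_const (fun r _ => hb x r)
      simpa using this
    have e3 : ∀ k : ℝ, κ * a x ≤ ∫ r in (k - κ)..k, h x r := fun k => by
      have := intervalIntegral.integral_mono_on (by linarith) intervalIntegrable_const
        (hint x (k - κ) k) (fun r _ => ha x r)
      simpa using this
    have := e2 (((0 : ℕ) : ℝ) + 1)
    have := e3 ((N : ℝ) + 1)
    linarith
  by_contra! hcon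
  have hlt : ∫ r in (0 : ℝ)..1, (∑ x, p x * ∑ n ∈ Finset.range N,
      (h x (r + ((n + 1 : ℕ) : ℝ) - κ) - h x (r + ((n + 1 : ℕ) : ℝ)))) ≤
        ∑ x, p x * (κ * (b - a x)) := by
    rw [intervalIntegral.integral_finsetSum fun x _ => (hint3 x).const_mul _]
    refine Finset.sum_le_sum fun x _ => ?_
    rw [intervalIntegral.integral_const_mul]
    exact mul_le_mul_of_nonneg_left (hloss x) (hp x)
  have hint4 : IntervalIntegrable (fun r => ∑ x, p x * ∑ n ∈ Finset.range N,
      (h x (r + ((n + 1 : ℕ) : ℝ) - κ) - h x (r + ((n + 1 : ℕ) : ℝ))))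
      MeasureTheory.volume 0 1 := by
    have := IntervalIntegrable.sum Finset.univ
      (f := fun x r => p x * ∑ n ∈ Finset.range N,
        (h x (r + ((n + 1 : ℕ) : ℝ) - κ) - h x (r + ((n + 1 : ℕ) : ℝ))))
      (μ := MeasureTheory.volume) (a := 0) (b := 1) fun x _ => (hint3 x).const_mul _
    simpa only [Finset.sum_fn] using this
  have hpos := intervalIntegral.intervalIntegral_pos_of_pos_on
    (hint4.sub (intervalIntegrable_const (c := ∑ x, p x * (κ * (b - a x)))))
    (fun r hr => sub_pos.2 (hcon r ⟨hr.1.le, hr.2.le⟩)) one_pos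
  rw [intervalIntegral.integral_sub hint4 intervalIntegrable_const] at hpos
  simp only [intervalIntegral.integral_const, sub_zero, one_smul] at hpos
  linarith

/-! ### Realizing the ultrametric, and the ratio of scales -/

/-- A metric space with a pinched ultrametric on it embeds into an ultrametric space. -/
theorem embedsIntoUltrametric_of_dist {Y : Type u} [MetricSpace Y] {D : ℝ} (ρ : Y → Y → ℝ)
    (h0 : ∀ x, ρ x x = 0) (hs : ∀ x y, ρ x y = ρ y x)
    (hu : ∀ x y z, ρ x z ≤ max (ρ x y) (ρ y z)) (hle : ∀ x y, ρ x y ≤ D * dist x y)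
    (hge : ∀ x y, dist x y ≤ ρ x y) : EmbedsIntoUltrametric D Y := by
  have hnn : ∀ x y, 0 ≤ ρ x y := fun x y => dist_nonneg.trans (hge x y)
  let m : MetricSpace Y :=
    { dist := ρ
      dist_self := h0
      dist_comm := hs
      dist_triangle := fun x y z => (hu x y z).trans
        (max_le (le_add_of_nonneg_right (hnn _ _)) (le_add_of_nonneg_left (hnn _ _)))
      eq_of_dist_eq_zero := fun {x y} h =>
        dist_le_zero.1 ((hge x y).trans (le_of_eq h)) }
  refine ⟨Y, m, ⟨hu⟩, id, 1, one_pos, fun x y => ?_⟩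
  rw [one_mul, mul_one]
  exact ⟨hge x y, hle x y⟩

/-- For the optimal ratio `s` of consecutive scales, `s + 2 / D = s ^ θ`. -/
theorem scale_add_eq {c θ : ℝ} (h0 : 0 < θ) (h1 : θ < 1)
    (hc : c = (1 - θ) * θ ^ (θ / (1 - θ))) :
    θ ^ (1 / (1 - θ)) + c = (θ ^ (1 / (1 - θ))) ^ θ := by
  have h2 : 1 - θ ≠ 0 := by linarith
  have e : (1 : ℝ) / (1 - θ) = 1 + θ / (1 - θ) := by field_simp; ring
  rw [← Real.rpow_mul h0.le, hc, one_div_mul_eq_div, e, Real.rpow_add h0, Real.rpow_one]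
  ring

/-! ### Choice of scales and the weight estimate -/

theorem mainTheorem7 (D : ℝ) (hD : 2 < D) {X : Type u} [Fintype X] [MetricSpace X]
    (w : X → ℝ) (hw : ∀ x, 0 < w x) :
    ∃ S : Finset X, EmbedsIntoUltrametric D (S : Set X) ∧
      (∑ x : X, w x) ^ dvoretzkyExponent D hD ≤ ∑ x ∈ S, w x ^ dvoretzkyExponent D hD := by
  classical
  obtain ⟨⟨hθ0, hθ1⟩, hθ⟩ := dvoretzkyExponent_spec D hD
  set θ := dvoretzkyExponent D hD
  have hD0 : 0 < D := by linarith
  rcases isEmpty_or_nonempty X with hX | hX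
  · refine ⟨∅, embedsIntoUltrametric_of_dist (fun _ _ => 0) ?_ ?_ ?_ ?_ ?_, ?_⟩
    · simp
    · simp
    · simp
    · intro x; exact (hX.false x.1).elim
    · intro x; exact (hX.false x.1).elim
    · simp [Real.zero_rpow hθ0.ne']
  -- This `s` maximizes `u ^ θ - u` over `u > 0`, and the maximum is `2 / D`.
  set s : ℝ := θ ^ (1 / (1 - θ)) with hs
  have hs0 : 0 < s := Real.rpow_pos_of_pos hθ0 _
  have hs1 : s < 1 := Real.rpow_lt_one hθ0.le hθ1 (one_div_pos.2 (by linarith))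
  have hsc : s + 2 / D = s ^ θ := scale_add_eq hθ0 hθ1 hθ
  -- The factor `s` leaves room for any shift `r ≤ 1` of the top scale.
  obtain ⟨M, hM0, hM⟩ : ∃ M : ℝ, 0 < M ∧ ∀ x y : X, dist x y ≤ 2 * (M * s) := by
    obtain ⟨B, hB⟩ := (Set.finite_range fun q : X × X => dist q.1 q.2).bddAbove
    have hB' : ∀ x y : X, dist x y ≤ B := fun x y => hB ⟨(x, y), rfl⟩
    refine ⟨(|B| + 1) / s, by positivity, fun x y => ?_⟩
    rw [div_mul_cancel₀ _ hs0.ne']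
    linarith [hB' x y, le_abs_self B, abs_nonneg B]
  obtain ⟨δ, hδ0, hδ⟩ : ∃ δ : ℝ, 0 < δ ∧ ∀ x y : X, x ≠ y → δ ≤ dist x y := by
    have hev : ∀ q : X × X, ∀ᶠ δ : ℝ in nhdsWithin 0 (Set.Ioi 0), q.1 ≠ q.2 →
        δ ≤ dist q.1 q.2 := by
      intro q
      by_cases hq : q.1 = q.2
      · simp [hq]
      · filter_upwards [Ioo_mem_nhdsGT (dist_pos.2 hq)] with δ hδ _ using hδ.2.le
    obtain ⟨δ, h1, h2⟩ := ((Filter.eventually_all.2 hev).and self_mem_nhdsWithin).exists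
    exact ⟨δ, h2, fun x y => h1 (x, y)⟩
  -- Below the minimal distance `δ`, the error term `2 * R N` is harmless.
  obtain ⟨N, hN⟩ : ∃ N : ℕ, 2 * (M * s ^ N) < δ := by
    obtain ⟨N, hN⟩ := exists_pow_lt_of_lt_one (show 0 < δ / (2 * M) by positivity) hs1
    refine ⟨N, ?_⟩
    rw [lt_div_iff₀ (by positivity)] at hN
    linarith
  set W : ℝ := ∑ x, w x with hW
  have hW0 : 0 < W := Finset.sum_pos (fun x _ => hw x) Finset.univ_nonempty
  have hscale : ∀ r : ℝ, 0 < M * s ^ r := fun r => mul_pos hM0 (Real.rpow_pos_of_pos hs0 r)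
  have hbw : ∀ x r, w x ≤ ballWeight w Finset.univ x (M * s ^ (r : ℝ)) := fun x r =>
    le_ballWeight hw (Finset.mem_univ x) (hscale r).le
  have hbp : ∀ x r, 0 < ballWeight w Finset.univ x (M * s ^ (r : ℝ)) := fun x r =>
    (hw x).trans_le (hbw x r)
  obtain ⟨r, ⟨hr0, hr1⟩, hr⟩ := exists_shift_sum_le (p := fun x => w x / W)
    (a := fun x => Real.log (w x))
    (h := fun x r => Real.log (ballWeight w Finset.univ x (M * s ^ r)))
    (b := Real.log W) (κ := 1 - θ) (fun x => (div_pos (hw x) hW0).le) (by linarith)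
    (fun x r r' hrr' => Real.log_le_log (hbp x r') (ballWeight_mono hw _ x
      (mul_le_mul_of_nonneg_left (Real.rpow_le_rpow_of_exponent_ge hs0 hs1.le hrr') hM0.le)))
    (fun x r => Real.log_le_log (hw x) (hbw x r))
    (fun x r => Real.log_le_log (hbp x r) (ballWeight_le_sum hw _ x _)) N
  obtain ⟨S, ρ, h0, hsy, hu, hd, hsum⟩ := exists_subset_ultrametric hw hD0
    (R := fun n => M * s ^ (r + (n : ℝ))) (fun n => hscale _)
    (fun x y => (hM x y).trans (by
      have : s ^ (1 : ℝ) ≤ s ^ (r + ((0 : ℕ) : ℝ)) :=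
        Real.rpow_le_rpow_of_exponent_ge hs0 hs1.le (by simpa using hr1)
      rw [Real.rpow_one] at this
      gcongr)) N fun x => w x ^ θ
  refine ⟨S, embedsIntoUltrametric_of_dist (fun x y => ρ x y) (fun x => h0 x)
    (fun x y => hsy x y) (fun x y z => hu x y z)
    (fun x y => (hd x x.2 y y.2).1) (fun x y => ?_), le_trans ?_ hsum⟩
  · rcases eq_or_ne x y with rfl | hxy
    · simp [h0]
    · refine (le_max_iff.1 (hd x x.2 y y.2).2).resolve_right (not_le.2 ?_)
      refine lt_of_lt_of_le ?_ (hδ x y fun h => hxy (Subtype.ext h))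
      refine lt_of_le_of_lt ?_ hN
      have : s ^ (r + (N : ℝ)) ≤ s ^ (N : ℝ) :=
        Real.rpow_le_rpow_of_exponent_ge hs0 hs1.le (by linarith)
      rw [Real.rpow_natCast] at this
      gcongr
  set G : X → ℝ := fun x => ∑ n ∈ Finset.range N,
    (Real.log (ballWeight w Finset.univ x (M * s ^ (r + ((n + 1 : ℕ) : ℝ) - (1 - θ))))
      - Real.log (ballWeight w Finset.univ x (M * s ^ (r + ((n + 1 : ℕ) : ℝ))))) with hG
  have hprod : ∀ x, ∏ n ∈ Finset.range N,
      (ballWeight w Finset.univ x (M * s ^ (r + ((n + 1 : ℕ) : ℝ))) /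
        ballWeight w Finset.univ x (M * s ^ (r + ((n + 1 : ℕ) : ℝ))
          + 2 / D * (M * s ^ (r + (n : ℝ))))) = Real.exp (-G x) := by
    intro x
    rw [hG, ← Finset.sum_neg_distrib, Real.exp_sum]
    refine Finset.prod_congr rfl fun n _ => ?_
    have e : M * s ^ (r + ((n + 1 : ℕ) : ℝ)) + 2 / D * (M * s ^ (r + (n : ℝ)))
        = M * s ^ (r + ((n + 1 : ℕ) : ℝ) - (1 - θ)) := by
      have e1 : r + ((n + 1 : ℕ) : ℝ) = r + n + 1 := by push_cast; ring
      have e2 : r + ((n + 1 : ℕ) : ℝ) - (1 - θ) = r + n + θ := by push_cast; ring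
      rw [e2, e1, Real.rpow_add hs0 (r + n) θ, Real.rpow_add hs0 (r + n) 1, Real.rpow_one, ← hsc]
      ring
    rw [e, neg_sub, Real.exp_sub, Real.exp_log (hbp _ _), Real.exp_log (hbp _ _)]
  -- Tangent line of `exp` at `0`, after writing `w x ^ θ` as `W ^ θ * (w x / W) * exp ((1 - θ) *
  -- log (W / w x))`. The choice of `r` makes the mean of the linear terms nonnegative.
  have hterm : ∀ x, W ^ θ * (w x / W * (1 + (1 - θ) * (Real.log W - Real.log (w x)) - G x))
      ≤ w x ^ θ * Real.exp (-G x) := by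
    intro x
    have e1 : w x ^ θ = W ^ θ * (w x / W) *
        Real.exp ((1 - θ) * (Real.log W - Real.log (w x))) := by
      rw [Real.rpow_def_of_pos (hw x), Real.rpow_def_of_pos hW0]
      nth_rewrite 2 [← Real.exp_log (hw x)]
      nth_rewrite 2 [← Real.exp_log hW0]
      rw [← Real.exp_sub, ← Real.exp_add, ← Real.exp_add]
      congr 1
      ring
    rw [e1, mul_assoc, ← Real.exp_add, ← mul_assoc]
    refine mul_le_mul_of_nonneg_left ?_
      (mul_pos (Real.rpow_pos_of_pos hW0 _) (div_pos (hw x) hW0)).le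
    have := Real.add_one_le_exp ((1 - θ) * (Real.log W - Real.log (w x)) + -G x)
    linarith
  calc W ^ θ = W ^ θ * 1 := (mul_one _).symm
    _ ≤ W ^ θ * ∑ x, w x / W * (1 + (1 - θ) * (Real.log W - Real.log (w x)) - G x) := by
        refine mul_le_mul_of_nonneg_left ?_ (Real.rpow_pos_of_pos hW0 _).le
        have e1 : ∑ x, w x / W = 1 := by
          rw [← Finset.sum_div, ← hW, div_self hW0.ne']
        have e2 : ∑ x, w x / W * (1 + (1 - θ) * (Real.log W - Real.log (w x)) - G x)
            = ∑ x, w x / W + ∑ x, w x / W * ((1 - θ) * (Real.log W - Real.log (w x)))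
              - ∑ x, w x / W * G x := by
          rw [← Finset.sum_add_distrib, ← Finset.sum_sub_distrib]
          exact Finset.sum_congr rfl fun x _ => by ring
        rw [e2, e1]
        linarith
    _ ≤ _ := by
        rw [Finset.mul_sum]
        refine Finset.sum_le_sum fun x _ => ?_
        rw [hprod x]
        exact hterm x
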